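/- Let $\mathbb F$ be a field, let $S_1,\dots,S_N$ be finite totally ordered sets, let $P = S_1\times\cdots\times S_N$ carry the product partial order, regarded as a category, and let $F\colon P\to \mathsf{Vec}_{\mathbb F}$ be a functor. Assume that $F$ is pointwise finite-dimensional, i.e. $F(x)$ is finite-dimensional for every $x\in P$, and that $F$ is of bidegree $1$, i.e. $F$ sends every square in $P$ that is both a pullback and a pushout in $P$ (equivalently, every square $x\wedge y\le x,y\le x\vee y$) to a square in $\mathsf{Vec}_{\mathbb F}$ that is both a pullback (degree $1$) and a pushout (codegree $1$). Then $F$ is interval decomposable: there is a family $(I_b)_{b\in B}$ of intervals in $P$, possibly with repetitions, such that $$F\;\cong\;\bigoplus_{b\in B}\mathbb F_{I_b}$$ as functors $P\to\mathsf{Vec}_{\mathbb F}$. Here an interval in $P$ is a nonempty subset $I\subseteq P$ such that $x\le z\le y$ with $x,y\in I$ implies $z\in I$, and such that any two points of $I$ are connected by a finite zigzag of order relations between points of $I$. The interval module $\mathbb F_I$ has $\mathbb F_I(x)=\mathbb F$ for $x\in I$ and $\mathbb F_I(x)=0$ otherwise, and $\mathbb F_I(x\le y)$ is the identity of $\mathbb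 F$ if $x,y\in I$ and zero otherwise. -/

import Mathlib

open CategoryTheory CategoryTheory.Limits

universe u v w

/-- A persistence module over a poset `P`: a functor from `P`, regarded as a category through its
order, to vector spaces over `K`. (On a product of posets this is the category of the product
partial order.) -/
abbrev PersistenceModule (K : Type u) [Field K] (P : Type v) [PartialOrder P] :
    Type (max v (u + 1)) :=
  P ⥤ ModuleCat.{u} K

namespace PersistenceModule

variable {K : Type u} [Field K] {P : Type v} [PartialOrder P]

/-- Pointwise finite-dimensional. -/
def IsPFD (F : PersistenceModule K P) : Prop :=
  ∀ x : P, FiniteDimensional K (F.obj x)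

/-- Degree 1: bicartesian 2-cubes (squares) in `P` are sent to cartesian 2-cubes (pullbacks).
A 2-cube has no other face of dimension at least two, so for a square "strongly bicartesian" means
bicartesian in the category `P`. -/
def IsDegreeOne (F : PersistenceModule K P) : Prop :=
  ∀ ⦃a x y b : P⦄ (f : a ⟶ x) (g : a ⟶ y) (h : x ⟶ b) (i : y ⟶ b),
    BicartesianSq f g h i → IsPullback (F.map f) (F.map g) (F.map h) (F.map i)

/-- Codegree 1: bicartesian 2-cubes (squares) in `P` are sent to cocartesian 2-cubes (pushouts). -/
def IsCodegreeOne (F : PersistenceModule K P) : Prop :=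
  ∀ ⦃a x y b : P⦄ (f : a ⟶ x) (g : a ⟶ y) (h : x ⟶ b) (i : y ⟶ b),
    BicartesianSq f g h i → IsPushout (F.map f) (F.map g) (F.map h) (F.map i)

/-- Bidegree 1: both degree 1 and codegree 1. -/
def IsBidegreeOne (F : PersistenceModule K P) : Prop :=
  F.IsDegreeOne ∧ F.IsCodegreeOne

/-- An interval in `P`: a nonempty convex subset any two points of which are joined, inside the
subset, by a finite zigzag of order relations. -/
structure IsInterval (I : Set P) : Prop where
  nonempty : I.Nonempty
  ordConnected : I.OrdConnected
  zigzag : ∀ x y : I, Relation.ReflTransGen (fun a b : I => a ≤ b ∨ b ≤ a) x y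

open Classical in
/-- The interval module of a convex set `I`. Its value at `x` is the space of functions from the
proofs of `x ∈ I` to `K`, that is, `K` if `x ∈ I` and `0` otherwise; the structure map from `x` to
`y` is the identity of `K` if `x, y ∈ I` and zero otherwise. -/
noncomputable def intervalModule (K : Type u) [Field K] (I : Set P) (hI : I.OrdConnected) :
    PersistenceModule K P where
  obj x := ModuleCat.of K (PLift (x ∈ I) → K)
  map {x y} _ := ModuleCat.ofHom
    { toFun := fun s _ => if hx : x ∈ I then s ⟨hx⟩ else 0
      map_add' := fun s t => by ext; by_cases hx : x ∈ I <;> simp [hx]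
      map_smul' := fun c s => by ext; by_cases hx : x ∈ I <;> simp [hx] }
  map_id x := by
    refine ModuleCat.hom_ext (LinearMap.ext fun s => funext fun hx => ?_)
    simp [hx.down]
  map_comp {x y z} f g := by
    refine ModuleCat.hom_ext (LinearMap.ext fun s => funext fun hz => ?_)
    by_cases hx : x ∈ I
    · have hy : y ∈ I := hI.out hx hz.down ⟨leOfHom f, leOfHom g⟩
      simp [hx, hy]
    · simp [hx]

/-- `F` is isomorphic to a direct sum (coproduct of persistence modules) of a family of interval
modules, in which an interval may occur repeatedly. -/
def IsIntervalDecomposable (F : PersistenceModule K P) : Prop :=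
  ∃ (B : Type u) (I : B → Set P) (hI : ∀ b, IsInterval (I b)),
    Nonempty (F ≅ ∐ fun b => intervalModule K (I b) (hI b).ordConnected)

end PersistenceModule

/-!
By induction on the total dimension it suffices to split one interval summand off a nonzero module
`F` of bidegree 1. A vector of `F a` that vanishes outside `Icc a b`, and whose image in `F b` is
not generated by the images of the points outside `Icc a b`, spans such a summand, supported on
`Icc a b`.

If `F ⊥ ≠ 0`, then either `F ⊥ ⟶ F ⊤` is injective and any nonzero vector of `F ⊥` spans a
summand supported everywhere, or, as pullback squares propagate injectivity from the axes to `⊤`,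
some nonzero vector of `F ⊥` dies along an axis `i`. If `m` is the last coordinate at which it is
alive on that axis, it spans a summand supported on the slab `{x | x i ≤ m}`. If `F ⊥ = 0`, then
`F` is nonzero on some axis `i`, because pushout squares generate every value from the axes, and a
vector born there at the least possible coordinate `s` and last alive at `m` spans a summand
supported on `{x | s ≤ x i ≤ m}`. In both cases the pullback squares formed by a point of the axis
and a slab show that the vector stays nonzero, respectively not generated from outside, at the top
of the slab.
-/

section Retracts

variable {C D : Type*} [Category* C] [Category* D]

lemma isPullback_map_of_retract {F G : C ⥤ D} (ρ : Retract F G) {a x y b : C} {f : a ⟶ x}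
    {g : a ⟶ y} {h : x ⟶ b} {i : y ⟶ b} (w : f ≫ h = g ≫ i)
    (hG : IsPullback (G.map f) (G.map g) (G.map h) (G.map i)) :
    IsPullback (F.map f) (F.map g) (F.map h) (F.map i) := by
  have hρ (z : C) : ρ.i.app z ≫ ρ.r.app z = 𝟙 (F.obj z) := by
    rw [← NatTrans.comp_app, ρ.retract, NatTrans.id_app]
  have hw (s : PullbackCone (F.map h) (F.map i)) :
      (s.fst ≫ ρ.i.app x) ≫ G.map h = (s.snd ≫ ρ.i.app y) ≫ G.map i := by
    simp only [Category.assoc, ← NatTrans.naturality, s.condition_assoc]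
  refine ⟨⟨by rw [← F.map_comp, w, F.map_comp]⟩, ⟨PullbackCone.IsLimit.mk _
    (fun s => hG.lift _ _ (hw s) ≫ ρ.r.app a) (fun s => ?_) (fun s => ?_) (fun s m hm hm' => ?_)⟩⟩
  · rw [Category.assoc, ← NatTrans.naturality, hG.lift_fst_assoc, Category.assoc, hρ,
      Category.comp_id]
  · rw [Category.assoc, ← NatTrans.naturality, hG.lift_snd_assoc, Category.assoc, hρ,
      Category.comp_id]
  · have : m ≫ ρ.i.app a = hG.lift _ _ (hw s) :=
      hG.hom_ext (by rw [hG.lift_fst, Category.assoc, ← NatTrans.naturality, reassoc_of% hm])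
        (by rw [hG.lift_snd, Category.assoc, ← NatTrans.naturality, reassoc_of% hm'])
    rw [← this, Category.assoc, hρ, Category.comp_id]

lemma isPushout_map_of_retract {F G : C ⥤ D} (ρ : Retract F G) {a x y b : C} {f : a ⟶ x}
    {g : a ⟶ y} {h : x ⟶ b} {i : y ⟶ b} (w : f ≫ h = g ≫ i)
    (hG : IsPushout (G.map f) (G.map g) (G.map h) (G.map i)) :
    IsPushout (F.map f) (F.map g) (F.map h) (F.map i) := by
  have ρ' : Retract F.op G.op :=
    ⟨NatTrans.op ρ.r, NatTrans.op ρ.i, by rw [← NatTrans.op_comp, ρ.retract, NatTrans.op_id]⟩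
  exact (isPullback_map_of_retract ρ' (f := i.op) (g := h.op) (h := g.op) (i := f.op)
    (congrArg Quiver.Hom.op w.symm) hG.op).unop

lemma nonempty_iso_coprod_cokernel [Preadditive C] [HasBinaryCoproducts C] {X Y : C} (f : X ⟶ Y)
    [IsSplitMono f] [HasCokernel f] : Nonempty (Y ≅ X ⨿ cokernel f) :=
  have hY := isBilimitBinaryBiconeOfIsSplitMonoOfCokernel (cokernelIsCokernel f)
  ⟨hY.isColimit.coconePointUniqueUpToIso (colimit.isColimit _)⟩

end Retracts

namespace PersistenceModule

variable {K : Type u} [Field K] {P : Type v}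

section PartialOrder

variable [PartialOrder P] {F G : PersistenceModule K P}

/-- The value of `F` at `x`. On a product of posets, `F.obj x` would instead be elaborated with
respect to the product of the categories `S i`. -/
abbrev stalk (F : PersistenceModule K P) (x : P) : ModuleCat.{u} K :=
  F.obj x

lemma isZero_iff_forall_isZero_stalk : IsZero F ↔ ∀ x, IsZero (F.stalk x) :=
  Functor.isZero_iff F

lemma IsPFD.of_epi (hF : F.IsPFD) (q : F ⟶ G) [Epi q] : G.IsPFD := fun x =>
  have := hF x
  Module.Finite.of_surjective (q.app x).hom ((ModuleCat.epi_iff_surjective _).1 inferInstance)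

instance isStableUnderRetracts_isBidegreeOne :
    ObjectProperty.IsStableUnderRetracts (C := PersistenceModule K P) IsBidegreeOne where
  of_retract ρ hG :=
    ⟨fun _ _ _ _ _ _ _ _ sq => isPullback_map_of_retract ρ sq.w (hG.1 _ _ _ _ sq),
      fun _ _ _ _ _ _ _ _ sq => isPushout_map_of_retract ρ sq.w (hG.2 _ _ _ _ sq)⟩

lemma isIntervalDecomposable_of_isZero (hF : IsZero F) : F.IsIntervalDecomposable :=
  ⟨PEmpty, PEmpty.elim, fun b => b.elim, ⟨hF.iso ((IsZero.iff_id_eq_zero _).2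
    (Sigma.hom_ext _ _ fun b => b.elim))⟩⟩

lemma isIntervalDecomposable_intervalModule {I : Set P} (hI : IsInterval I) :
    (intervalModule K I hI.ordConnected).IsIntervalDecomposable :=
  ⟨PUnit, fun _ => I, fun _ => hI,
    ⟨(coproductUniqueIso fun _ : PUnit => intervalModule K I hI.ordConnected).symm⟩⟩

lemma IsIntervalDecomposable.of_iso (hG : G.IsIntervalDecomposable) (e : F ≅ G) :
    F.IsIntervalDecomposable :=
  let ⟨B, I, hI, ⟨e'⟩⟩ := hG
  ⟨B, I, hI, ⟨e ≪≫ e'⟩⟩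

lemma IsIntervalDecomposable.coprod (hF : F.IsIntervalDecomposable)
    (hG : G.IsIntervalDecomposable) : (F ⨿ G).IsIntervalDecomposable := by
  obtain ⟨B, I, hI, ⟨e⟩⟩ := hF
  obtain ⟨B', I', hI', ⟨e'⟩⟩ := hG
  refine ⟨B ⊕ B', Sum.elim I I', Sum.rec hI hI', ⟨coprod.mapIso e e' ≪≫ ?_⟩⟩
  refine (Cofan.combPairIsColimit (coproductIsCoproduct _) (coproductIsCoproduct _)
    (coprodIsCoprod _ _)).coconePointUniqueUpToIso (coproductIsCoproduct _) ≪≫ Sigma.mapIso ?_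
  rintro (b | b) <;> exact Iso.refl _

/-- The sum of the dimensions of the values of a persistence module over a finite poset; the
induction that peels off interval summands runs on it. -/
noncomputable def totalDim [Fintype P] (F : PersistenceModule K P) : ℕ :=
  ∑ x, Module.finrank K (F.obj x)

lemma totalDim_lt_of_epi_of_not_mono [Fintype P] (hF : F.IsPFD) (q : F ⟶ G) [Epi q]
    (hq : ¬ Mono q) : G.totalDim < F.totalDim := by
  have hsurj (x : P) : Function.Surjective (q.app x).hom :=
    (ModuleCat.epi_iff_surjective _).1 inferInstance
  have hle (x : P) : Module.finrank K (G.obj x) ≤ Module.finrank K (F.obj x) :=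
    have := hF x
    LinearMap.finrank_le_finrank_of_surjective (hsurj x)
  obtain ⟨x, hx⟩ := not_forall.1 (mt (NatTrans.mono_iff_mono_app q).2 hq)
  have := hF x
  have := hF.of_epi q x
  refine Finset.sum_lt_sum (fun y _ => hle y)
    ⟨x, Finset.mem_univ x, (hle x).lt_of_ne fun h => hx ?_⟩
  exact (ModuleCat.mono_iff_injective _).2
    ((LinearMap.injective_iff_surjective_of_finrank_eq_finrank h.symm).2 (hsurj x))

/-- `F` has an interval module as a direct summand; a summand is encoded as a retract, since
retracts split off in the abelian category of persistence modules. -/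
def HasIntervalSummand (F : PersistenceModule K P) : Prop :=
  ∃ (I : Set P) (hI : IsInterval I), Nonempty (Retract (intervalModule K I hI.ordConnected) F)

lemma not_isZero_intervalModule {I : Set P} (hI : IsInterval I) :
    ¬ IsZero (intervalModule K I hI.ordConnected) := by
  obtain ⟨x, hx⟩ := hI.nonempty
  intro h
  have : Subsingleton (PLift (x ∈ I) → K) :=
    ModuleCat.subsingleton_of_isZero (isZero_iff_forall_isZero_stalk.1 h x)
  exact zero_ne_one (congrFun (Subsingleton.elim (0 : PLift (x ∈ I) → K) 1) ⟨hx⟩)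

theorem isIntervalDecomposable_of_forall_hasIntervalSummand [Finite P]
    (Q : ObjectProperty (PersistenceModule K P)) [Q.IsStableUnderRetracts]
    (hQ : ∀ F, Q F → ¬ IsZero F → F.HasIntervalSummand) (hfin : F.IsPFD) (hF : Q F) :
    F.IsIntervalDecomposable := by
  have := Fintype.ofFinite P
  induction hn : F.totalDim using Nat.strong_induction_on generalizing F with
  | _ n ih =>
  by_cases hF0 : IsZero F
  · exact isIntervalDecomposable_of_isZero hF0
  obtain ⟨I, hI, ⟨ρ⟩⟩ := hQ F hF hF0
  have ρ' : Retract (cokernel ρ.i) F :=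
    (binaryBiconeOfIsSplitMonoOfCokernel (cokernelIsCokernel ρ.i)).retract_right
  have hπ : ¬ Mono (cokernel.π ρ.i) := fun _ => not_isZero_intervalModule hI <|
    IsZero.of_mono_eq_zero ρ.i (zero_of_comp_mono _ (cokernel.condition ρ.i))
  have hlt := hn ▸ totalDim_lt_of_epi_of_not_mono hfin (cokernel.π ρ.i) hπ
  obtain ⟨e⟩ := nonempty_iso_coprod_cokernel ρ.i
  exact ((isIntervalDecomposable_intervalModule hI).coprod
    (ih _ hlt (hfin.of_epi (cokernel.π ρ.i)) (Q.prop_of_retract ρ' hF) rfl)).of_iso e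

/-- The structure map of `F` along an order relation. -/
noncomputable def mapLE (F : PersistenceModule K P) {x y : P} (h : x ≤ y) :
    F.stalk x →ₗ[K] F.stalk y :=
  (F.map (homOfLE h)).hom

lemma mapLE_refl {x : P} (h : x ≤ x) (v : F.stalk x) : F.mapLE h v = v := by
  simp [mapLE]

lemma mapLE_mapLE {x y z : P} (h : x ≤ y) (h' : y ≤ z) (v : F.stalk x) :
    F.mapLE h' (F.mapLE h v) = F.mapLE (h.trans h') v := by
  simp only [mapLE, ← homOfLE_comp h h', F.map_comp, ModuleCat.hom_comp, LinearMap.comp_apply]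

lemma injective_mapLE_of_ge {x y : P} (h : x ≤ y) (h' : y ≤ x) :
    Function.Injective (F.mapLE h) :=
  Function.LeftInverse.injective (g := F.mapLE h') fun v => by rw [mapLE_mapLE, mapLE_refl]

lemma isInterval_Icc {a b : P} (h : a ≤ b) : IsInterval (Set.Icc a b) where
  nonempty := ⟨a, le_rfl, h⟩
  ordConnected := Set.ordConnected_Icc
  zigzag x y := .tail (b := ⟨a, le_rfl, h⟩) (.single (Or.inr x.2.1)) (Or.inl y.2.1)

/-- The structure map of the interval module of `I`, between the spaces of functions that its
values unfold to. -/
noncomputable def intervalMapLE {I : Set P} (hI : I.OrdConnected) {x y : P} (h : x ≤ y) :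
    (PLift (x ∈ I) → K) →ₗ[K] PLift (y ∈ I) → K :=
  (intervalModule K I hI).mapLE h

lemma intervalMapLE_of_mem {I : Set P} (hI : I.OrdConnected) {x y : P} (h : x ≤ y) (hx : x ∈ I)
    (s : PLift (x ∈ I) → K) (hy : PLift (y ∈ I)) : intervalMapLE hI h s hy = s ⟨hx⟩ :=
  dif_pos hx

lemma intervalMapLE_of_notMem {I : Set P} (hI : I.OrdConnected) {x y : P} (h : x ≤ y)
    (hx : x ∉ I) (s : PLift (x ∈ I) → K) (hy : PLift (y ∈ I)) : intervalMapLE hI h s hy = 0 :=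
  dif_neg hx

open Classical in
/-- A vector in `F a` whose image vanishes at every point outside `Icc a b` determines a morphism
from the interval module of `Icc a b` to `F`. -/
noncomputable def ofIcc {a b : P} (v : F.stalk a)
    (hv : ∀ x (h : a ≤ x), ¬ x ≤ b → F.mapLE h v = 0) :
    intervalModule K (Set.Icc a b) Set.ordConnected_Icc ⟶ F where
  app x := ModuleCat.ofHom
    (Fintype.linearCombination K fun hx : PLift (x ∈ Set.Icc a b) => F.mapLE hx.down.1 v)
  naturality x y f := by
    refine ModuleCat.hom_ext (LinearMap.ext fun s : PLift (x ∈ Set.Icc a b) → K => ?_)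
    change ∑ hy : PLift (y ∈ Set.Icc a b),
        intervalMapLE Set.ordConnected_Icc (leOfHom f) s hy • F.mapLE hy.down.1 v =
      F.mapLE (leOfHom f) (∑ hx : PLift (x ∈ Set.Icc a b), s hx • F.mapLE hx.down.1 v)
    by_cases hx : x ∈ Set.Icc a b
    · have hay : a ≤ y := hx.1.trans (leOfHom f)
      rw [Fintype.sum_subsingleton (fun h : PLift (x ∈ Set.Icc a b) => s h • _) ⟨hx⟩, map_smul,
        mapLE_mapLE]
      simp only [intervalMapLE_of_mem _ _ hx]
      by_cases hyb : y ≤ b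
      · exact Fintype.sum_subsingleton _ ⟨hay, hyb⟩
      · simp only [hv y hay hyb, smul_zero, Finset.sum_const_zero]
    · have : IsEmpty (PLift (x ∈ Set.Icc a b)) := ⟨fun h => hx h.down⟩
      simp only [intervalMapLE_of_notMem _ _ hx, zero_smul, Finset.sum_const_zero,
        Fintype.sum_empty, map_zero]

/-- A functional on `F b` that vanishes on the images of all points outside `Icc a b` determines a
morphism from `F` to the interval module of `Icc a b`. -/
noncomputable def toIcc {a b : P} (l : F.stalk b →ₗ[K] K)
    (hl : ∀ x (h : x ≤ b), ¬ a ≤ x → l ∘ₗ F.mapLE h = 0) :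
    F ⟶ intervalModule K (Set.Icc a b) Set.ordConnected_Icc where
  app x := ModuleCat.ofHom
    (LinearMap.pi fun hx : PLift (x ∈ Set.Icc a b) => l ∘ₗ F.mapLE hx.down.2)
  naturality x y f := by
    refine ModuleCat.hom_ext (LinearMap.ext fun w => funext fun hy : PLift (y ∈ Set.Icc a b) => ?_)
    have hxb : x ≤ b := (leOfHom f).trans hy.down.2
    change l (F.mapLE hy.down.2 (F.mapLE (leOfHom f) w)) =
      intervalMapLE Set.ordConnected_Icc (leOfHom f)
        (fun hx : PLift (x ∈ Set.Icc a b) => l (F.mapLE hx.down.2 w)) hy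
    rw [mapLE_mapLE]
    by_cases hx : a ≤ x
    · rw [intervalMapLE_of_mem _ _ (Set.mem_Icc.2 ⟨hx, hxb⟩)]
    · rw [intervalMapLE_of_notMem _ _ fun h => hx h.1]
      exact LinearMap.congr_fun (hl x hxb hx) w

lemma ofIcc_comp_toIcc {a b : P} (hab : a ≤ b) {v : F.stalk a} {l : F.stalk b →ₗ[K] K}
    (hv : ∀ x (h : a ≤ x), ¬ x ≤ b → F.mapLE h v = 0)
    (hl : ∀ x (h : x ≤ b), ¬ a ≤ x → l ∘ₗ F.mapLE h = 0) (hlv : l (F.mapLE hab v) = 1) :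
    ofIcc v hv ≫ toIcc l hl = 𝟙 _ := by
  classical
  refine NatTrans.ext (funext fun x => ModuleCat.hom_ext
    (LinearMap.ext fun s : PLift (x ∈ Set.Icc a b) → K =>
      funext fun hx : PLift (x ∈ Set.Icc a b) => ?_))
  change l (F.mapLE hx.down.2 (Fintype.linearCombination K _ s)) = s hx
  rw [Fintype.linearCombination_apply, Fintype.sum_subsingleton _ hx, map_smul, mapLE_mapLE,
    map_smul, hlv, smul_eq_mul, mul_one]

lemma hasIntervalSummand_of_notMem {a b : P} (hab : a ≤ b) (v : F.stalk a)
    (W : Submodule K (F.stalk b)) (hv : ∀ x (h : a ≤ x), ¬ x ≤ b → F.mapLE h v = 0)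
    (hW : ∀ x (h : x ≤ b), ¬ a ≤ x → LinearMap.range (F.mapLE h) ≤ W)
    (hvW : F.mapLE hab v ∉ W) : F.HasIntervalSummand := by
  obtain ⟨l, hlv, hlW⟩ := Submodule.exists_le_ker_of_notMem hvW
  let l' : F.stalk b →ₗ[K] K := (l (F.mapLE hab v))⁻¹ • l
  have hl' (x : P) (h : x ≤ b) (hx : ¬ a ≤ x) : l' ∘ₗ F.mapLE h = 0 := by
    rw [LinearMap.smul_comp, LinearMap.range_le_ker_iff.1 ((hW x h hx).trans hlW), smul_zero]
  exact ⟨_, isInterval_Icc hab, ⟨ofIcc v hv, toIcc l' hl',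
    ofIcc_comp_toIcc hab hv hl' (inv_mul_cancel₀ hlv)⟩⟩

lemma hasIntervalSummand_of_bot [OrderBot P] {b : P} (v : F.stalk ⊥)
    (hv : ∀ x, ¬ x ≤ b → F.mapLE (bot_le : ⊥ ≤ x) v = 0)
    (hvb : F.mapLE (bot_le : ⊥ ≤ b) v ≠ 0) : F.HasIntervalSummand :=
  hasIntervalSummand_of_notMem bot_le v ⊥ (fun x _ hx => hv x hx)
    (fun _ _ hx => absurd bot_le hx) hvb

end PartialOrder

section Lattice

variable [Lattice P] {F : PersistenceModule K P}

lemma bicartesianSq_homOfLE {a x y b : P} (hax : a ≤ x) (hay : a ≤ y) (hxb : x ≤ b) (hyb : y ≤ b)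
    (ha : x ⊓ y ≤ a) (hb : b ≤ x ⊔ y) :
    BicartesianSq (homOfLE hax) (homOfLE hay) (homOfLE hxb) (homOfLE hyb) where
  w := rfl
  isLimit' := ⟨PullbackCone.IsLimit.mk _
    (fun s => homOfLE ((le_inf (leOfHom s.fst) (leOfHom s.snd)).trans ha))
    (fun _ => rfl) (fun _ => rfl) (fun _ _ _ _ => rfl)⟩
  isColimit' := ⟨PushoutCocone.IsColimit.mk _
    (fun s => homOfLE (hb.trans (sup_le (leOfHom s.inl) (leOfHom s.inr))))
    (fun _ => rfl) (fun _ => rfl) (fun _ _ _ _ => rfl)⟩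

lemma IsDegreeOne.eq_zero_of_mapLE_eq_zero (hF : F.IsDegreeOne) {a x y : P} (hax : a ≤ x)
    (hay : a ≤ y) (ha : x ⊓ y ≤ a) {v : F.stalk a} (hx : F.mapLE hax v = 0)
    (hy : F.mapLE hay v = 0) : v = 0 :=
  Types.ext_of_isPullback ((hF _ _ _ _ (bicartesianSq_homOfLE hax hay le_sup_left le_sup_right ha
    le_rfl)).map (forget (ModuleCat K)))
    (hx.trans (map_zero (F.mapLE hax)).symm) (hy.trans (map_zero (F.mapLE hay)).symm)

lemma IsDegreeOne.exists_mapLE_eq (hF : F.IsDegreeOne) {a x y b : P} (hax : a ≤ x) (hay : a ≤ y)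
    (hxb : x ≤ b) (hyb : y ≤ b) (ha : x ⊓ y ≤ a) (hb : b ≤ x ⊔ y) {p : F.stalk x} {q : F.stalk y}
    (h : F.mapLE hxb p = F.mapLE hyb q) : ∃ w : F.stalk a, F.mapLE hax w = p ∧ F.mapLE hay w = q :=
  Types.exists_of_isPullback ((hF _ _ _ _ (bicartesianSq_homOfLE hax hay hxb hyb ha hb)).map
    (forget (ModuleCat K))) p q h

lemma IsDegreeOne.injective_mapLE_sup [OrderBot P] (hF : F.IsDegreeOne) {x y : P}
    (hxy : Disjoint x y) (hx : Function.Injective (F.mapLE (bot_le : ⊥ ≤ x)))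
    (hy : Function.Injective (F.mapLE (bot_le : ⊥ ≤ y))) :
    Function.Injective (F.mapLE (bot_le : ⊥ ≤ x ⊔ y)) := by
  refine (injective_iff_map_eq_zero _).2 fun v hv => ?_
  obtain ⟨w, hw, hw'⟩ := hF.exists_mapLE_eq bot_le bot_le le_sup_left le_sup_right hxy.eq_bot.le
    le_rfl (p := F.mapLE bot_le v) (q := 0) (by rw [mapLE_mapLE, hv, map_zero])
  rwa [(map_eq_zero_iff _ hy).1 hw', map_zero, eq_comm, map_eq_zero_iff _ hx] at hw

lemma IsDegreeOne.injective_mapLE_finsetSup [OrderBot P] {ι : Type*} (hF : F.IsDegreeOne)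
    {t : Finset ι} {f : ι → P} (hf : t.SupIndep f)
    (hinj : ∀ i ∈ t, Function.Injective (F.mapLE (bot_le : ⊥ ≤ f i))) :
    Function.Injective (F.mapLE (bot_le : ⊥ ≤ t.sup f)) := by
  classical
  induction t using Finset.induction_on with
  | empty => exact injective_mapLE_of_ge _ Finset.sup_empty.le
  | insert i t hi ih =>
    rw [Finset.sup_insert]
    exact hF.injective_mapLE_sup (hf (Finset.subset_insert i t) (Finset.mem_insert_self i t) hi)
      (hinj i (Finset.mem_insert_self i t))
      (ih (hf.subset (Finset.subset_insert i t)) fun j hj => hinj j (Finset.mem_insert_of_mem hj))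

lemma IsCodegreeOne.isZero_sup (hF : F.IsCodegreeOne) {x y : P} (hx : IsZero (F.stalk x))
    (hy : IsZero (F.stalk y)) : IsZero (F.stalk (x ⊔ y)) :=
  (IsZero.iff_id_eq_zero _).2 ((hF _ _ _ _ (bicartesianSq_homOfLE inf_le_left inf_le_right
    le_sup_left le_sup_right le_rfl le_rfl)).hom_ext (hx.eq_of_src _ _) (hy.eq_of_src _ _))

end Lattice

section Points

variable {ι : Type*} [DecidableEq ι] {S : ι → Type*}

/-- The point of the `i`-th axis of a product of posets with coordinate `s`. -/
def axisPoint [∀ i, LE (S i)] [∀ i, OrderBot (S i)] (i : ι) (s : S i) : ∀ i, S i :=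
  Function.update ⊥ i s

/-- The largest point of a product of posets with `i`-th coordinate `m`; the points below it form
the slab `{x | x i ≤ m}`. -/
def slabTop [∀ i, LE (S i)] [∀ i, OrderTop (S i)] (i : ι) (m : S i) : ∀ i, S i :=
  Function.update ⊤ i m

lemma axisPoint_le_iff [∀ i, Preorder (S i)] [∀ i, OrderBot (S i)] {i : ι} {s : S i}
    {x : ∀ i, S i} : axisPoint i s ≤ x ↔ s ≤ x i := by
  simp [axisPoint, update_le_iff]

lemma le_slabTop_iff [∀ i, Preorder (S i)] [∀ i, OrderTop (S i)] {i : ι} {m : S i}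
    {x : ∀ i, S i} : x ≤ slabTop i m ↔ x i ≤ m := by
  simp [slabTop, le_update_iff]

lemma axisPoint_apply_self [∀ i, LE (S i)] [∀ i, OrderBot (S i)] (i : ι) (s : S i) :
    axisPoint i s i = s :=
  Function.update_self ..

lemma slabTop_apply_self [∀ i, LE (S i)] [∀ i, OrderTop (S i)] (i : ι) (m : S i) :
    slabTop i m i = m :=
  Function.update_self ..

lemma axisPoint_bot [∀ i, LE (S i)] [∀ i, OrderBot (S i)] (i : ι) :
    axisPoint i (⊥ : S i) = ⊥ :=
  Function.update_eq_self i ⊥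

lemma axisPoint_le_axisPoint_iff [∀ i, Preorder (S i)] [∀ i, OrderBot (S i)] {i : ι} {s t : S i} :
    axisPoint i s ≤ axisPoint i t ↔ s ≤ t := by
  rw [axisPoint_le_iff, axisPoint_apply_self]

lemma slabTop_le_slabTop_iff [∀ i, Preorder (S i)] [∀ i, OrderTop (S i)] {i : ι} {m n : S i} :
    slabTop i m ≤ slabTop i n ↔ m ≤ n := by
  rw [le_slabTop_iff, slabTop_apply_self]

lemma axisPoint_le_slabTop_iff [∀ i, Preorder (S i)] [∀ i, BoundedOrder (S i)] {i : ι}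
    {s m : S i} : axisPoint i s ≤ slabTop i m ↔ s ≤ m := by
  rw [axisPoint_le_iff, slabTop_apply_self]

lemma axisPoint_inf_slabTop_le [∀ i, Lattice (S i)] [∀ i, BoundedOrder (S i)] (i : ι)
    (s m : S i) : axisPoint i s ⊓ slabTop i m ≤ axisPoint i m := by
  intro j
  obtain rfl | hj := eq_or_ne j i
  · simp [axisPoint, slabTop]
  · simp [axisPoint, slabTop, hj]

lemma slabTop_le_axisPoint_sup_slabTop [∀ i, Lattice (S i)] [∀ i, BoundedOrder (S i)] (i : ι)
    (s m : S i) : slabTop i s ≤ axisPoint i s ⊔ slabTop i m := by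
  intro j
  obtain rfl | hj := eq_or_ne j i
  · simp [axisPoint, slabTop]
  · simp [axisPoint, slabTop, hj]

lemma sup_axisPoint [Fintype ι] [∀ i, Lattice (S i)] [∀ i, OrderBot (S i)] (x : ∀ i, S i) :
    Finset.univ.sup (fun i => axisPoint i (x i)) = x :=
  le_antisymm (Finset.sup_le fun _ _ => axisPoint_le_iff.2 le_rfl) fun i =>
    axisPoint_le_iff.1 (Finset.le_sup (f := fun i => axisPoint i (x i)) (Finset.mem_univ i))

lemma disjoint_axisPoint [∀ i, Lattice (S i)] [∀ i, OrderBot (S i)] {i j : ι} (hij : i ≠ j)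
    (s : S i) (t : S j) : Disjoint (axisPoint i s) (axisPoint j t) := by
  refine Pi.disjoint_iff.2 fun k => ?_
  obtain rfl | hk := eq_or_ne k i
  · simp [axisPoint, hij]
  · simp [axisPoint, hk]

end Points

section Axes

variable {ι : Type v} [Finite ι] [DecidableEq ι] {S : ι → Type w}

lemma IsCodegreeOne.isZero_of_isZero_axisPoint [∀ i, Lattice (S i)] [∀ i, OrderBot (S i)]
    {F : PersistenceModule K (∀ i, S i)} (hF : F.IsCodegreeOne) (h0 : IsZero (F.stalk ⊥))
    (hax : ∀ i (s : S i), IsZero (F.stalk (axisPoint i s))) : IsZero F := by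
  have := Fintype.ofFinite ι
  refine isZero_iff_forall_isZero_stalk.2 fun x => ?_
  rw [← sup_axisPoint x]
  exact Finset.sup_induction (p := fun x => IsZero (F.stalk x)) h0
    (fun _ hx _ hy => hF.isZero_sup hx hy) fun i _ => hax i (x i)

lemma IsDegreeOne.injective_mapLE_top_of_axisPoint [∀ i, DistribLattice (S i)]
    [∀ i, BoundedOrder (S i)] {F : PersistenceModule K (∀ i, S i)} (hF : F.IsDegreeOne)
    (hax : ∀ i, Function.Injective (F.mapLE (bot_le : ⊥ ≤ axisPoint i (⊤ : S i)))) :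
    Function.Injective (F.mapLE (bot_le : ⊥ ≤ ⊤)) := by
  have := Fintype.ofFinite ι
  have hdisj : Finset.univ.SupIndep fun i => axisPoint i (⊤ : S i) :=
    Set.PairwiseDisjoint.supIndep fun i _ j _ hij => disjoint_axisPoint hij ⊤ ⊤
  have hinj := hF.injective_mapLE_finsetSup hdisj fun i _ => hax i
  have hsup : (Finset.univ.sup fun i => axisPoint i (⊤ : S i)) = ⊤ := sup_axisPoint ⊤
  rwa [hsup] at hinj

end Axes

section Grid

variable {ι : Type v} {S : ι → Type w} [∀ i, LinearOrder (S i)] [∀ i, BoundedOrder (S i)]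
  {F : PersistenceModule K (∀ i, S i)}

lemma exists_mapLE_axisPoint_ne_zero [DecidableEq ι] {i : ι} [WellFoundedGT (S i)]
    {a : ∀ i, S i} {v : F.stalk a} {s : S i} (has : a ≤ axisPoint i s) (hv : F.mapLE has v ≠ 0) :
    ∃ (m : S i) (h : a ≤ axisPoint i m), F.mapLE h v ≠ 0 ∧
      ∀ x (hax : a ≤ x), ¬ x ≤ slabTop i m → F.mapLE hax v = 0 := by
  obtain ⟨m, ⟨ham, hm⟩, hmax⟩ := exists_maximal_of_wellFoundedGT
    (fun m : S i => ∃ h : a ≤ axisPoint i m, F.mapLE h v ≠ 0) ⟨s, has, hv⟩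
  refine ⟨m, ham, hm, fun x hax hx => ?_⟩
  rw [le_slabTop_iff] at hx
  have hmx : m ≤ x i := (not_le.1 hx).le
  have hax' : a ≤ axisPoint i (x i) := ham.trans (axisPoint_le_axisPoint_iff.2 hmx)
  have h0 : F.mapLE hax' v = 0 := of_not_not fun h => hx (hmax ⟨hax', h⟩ hmx)
  rw [← mapLE_mapLE hax' (axisPoint_le_iff.2 le_rfl), h0, map_zero]

lemma IsDegreeOne.hasIntervalSummand_of_not_isZero_axisPoint [DecidableEq ι] (hF : F.IsDegreeOne)
    (h0 : IsZero (F.stalk ⊥)) {i : ι} [Finite (S i)] {t : S i}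
    (ht : ¬ IsZero (F.stalk (axisPoint i t))) : F.HasIntervalSummand := by
  obtain ⟨s, hs, hmin⟩ := exists_minimal_of_wellFoundedLT
    (fun s : S i => ¬ IsZero (F.stalk (axisPoint i s))) ⟨t, ht⟩
  have hs_bot : ¬ IsMin s := fun h => hs <| by rwa [h.eq_bot, axisPoint_bot]
  obtain ⟨r, hr⟩ := exists_covBy_of_wellFoundedGT hs_bot
  have hr0 : IsZero (F.stalk (axisPoint i r)) :=
    of_not_not fun h => hr.lt.not_ge (hmin h hr.le)
  have := not_subsingleton_iff_nontrivial.1 (mt ModuleCat.isZero_iff_subsingleton.2 hs)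
  obtain ⟨v, hv⟩ := exists_ne (0 : F.stalk (axisPoint i s))
  obtain ⟨m, hsm, hvm, hdie⟩ :=
    exists_mapLE_axisPoint_ne_zero le_rfl (by rwa [mapLE_refl] : F.mapLE le_rfl v ≠ 0)
  -- `v` survives on `slabTop i m` modulo the image of `slabTop i r`: by the pullback property,
  -- whatever agrees there with the image of `v` comes from the zero space at `axisPoint i r`.
  have hrm : r ≤ m := hr.le.trans (axisPoint_le_axisPoint_iff.1 hsm)
  have hm : axisPoint i m ≤ slabTop i m := axisPoint_le_slabTop_iff.2 le_rfl
  have hrm' : slabTop i r ≤ slabTop i m := slabTop_le_slabTop_iff.2 hrm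
  refine hasIntervalSummand_of_notMem (hsm.trans hm) v (LinearMap.range (F.mapLE hrm')) hdie ?_ ?_
  · rintro x hxm hsx _ ⟨w, rfl⟩
    have hxr : x ≤ slabTop i r :=
      le_slabTop_iff.2 (hr.le_of_lt (not_le.1 (mt axisPoint_le_iff.2 hsx)))
    exact ⟨F.mapLE hxr w, mapLE_mapLE _ _ _⟩
  · rintro ⟨w, hw⟩
    obtain ⟨u, hu, -⟩ := hF.exists_mapLE_eq (axisPoint_le_axisPoint_iff.2 hrm)
      (axisPoint_le_slabTop_iff.2 le_rfl) hm hrm' (axisPoint_inf_slabTop_le i m r)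
      (slabTop_le_axisPoint_sup_slabTop i m r) ((mapLE_mapLE hsm hm v).trans hw.symm)
    have := ModuleCat.subsingleton_of_isZero hr0
    exact hvm (by rw [← hu, Subsingleton.elim u 0, map_zero])

lemma IsDegreeOne.hasIntervalSummand_of_mapLE_axisPoint_top_eq_zero [DecidableEq ι]
    (hF : F.IsDegreeOne) {i : ι} [WellFoundedGT (S i)] {v : F.stalk ⊥} (hv : v ≠ 0)
    (hv' : F.mapLE (bot_le : ⊥ ≤ axisPoint i ⊤) v = 0) : F.HasIntervalSummand := by
  have h_bot : ⊥ ≤ axisPoint i (⊥ : S i) := bot_le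
  obtain ⟨m, _, hvm, hdie⟩ := exists_mapLE_axisPoint_ne_zero h_bot
    ((map_ne_zero_iff _ (injective_mapLE_of_ge _ (axisPoint_bot i).le)).2 hv)
  refine hasIntervalSummand_of_bot (b := slabTop i m) v (fun x hx => hdie x bot_le hx) fun h => ?_
  refine hvm (hF.eq_zero_of_mapLE_eq_zero (axisPoint_le_axisPoint_iff.2 le_top)
    (axisPoint_le_slabTop_iff.2 le_rfl) (axisPoint_inf_slabTop_le i ⊤ m) ?_ ?_)
  · rw [mapLE_mapLE, hv']
  · rw [mapLE_mapLE, h]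

theorem IsBidegreeOne.hasIntervalSummand [Finite ι] [∀ i, Finite (S i)] (hF : F.IsBidegreeOne)
    (hF0 : ¬ IsZero F) : F.HasIntervalSummand := by
  classical
  by_cases h0 : IsZero (F.stalk ⊥)
  · obtain ⟨i, s, hs⟩ : ∃ i, ∃ s : S i, ¬ IsZero (F.stalk (axisPoint i s)) := by
      by_contra! hax
      exact hF0 (hF.2.isZero_of_isZero_axisPoint h0 hax)
    exact hF.1.hasIntervalSummand_of_not_isZero_axisPoint h0 hs
  by_cases htop : Function.Injective (F.mapLE (bot_le : ⊥ ≤ ⊤))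
  · have := not_subsingleton_iff_nontrivial.1 (mt ModuleCat.isZero_iff_subsingleton.2 h0)
    obtain ⟨v, hv⟩ := exists_ne (0 : F.stalk ⊥)
    exact hasIntervalSummand_of_bot v (fun x hx => absurd le_top hx)
      ((map_ne_zero_iff _ htop).2 hv)
  · obtain ⟨i, hi⟩ := not_forall.1 (mt hF.1.injective_mapLE_top_of_axisPoint htop)
    obtain ⟨v, hv', hv⟩ : ∃ v, F.mapLE bot_le v = 0 ∧ v ≠ 0 := by
      simpa [injective_iff_map_eq_zero] using hi
    exact hF.1.hasIntervalSummand_of_mapLE_axisPoint_top_eq_zero hv hv'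

end Grid

end PersistenceModule

theorem mainTheorem5 {K : Type u} [Field K] {ι : Type v} [Finite ι] (S : ι → Type w)
    [∀ i, LinearOrder (S i)] [∀ i, Finite (S i)]
    (F : PersistenceModule K (∀ i, S i)) (hfin : F.IsPFD) (hF : F.IsBidegreeOne) :
    F.IsIntervalDecomposable := by
  refine PersistenceModule.isIntervalDecomposable_of_forall_hasIntervalSummand
    PersistenceModule.IsBidegreeOne (fun G hG hG0 => ?_) hfin hF
  obtain ⟨x, -⟩ := not_forall.1 (mt PersistenceModule.isZero_iff_forall_isZero_stalk.2 hG0)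
  have (i : ι) : Nonempty (S i) := ⟨x i⟩
  have (i : ι) : Fintype (S i) := Fintype.ofFinite _
  let (i : ι) : BoundedOrder (S i) := Fintype.toBoundedOrder (S i)
  exact hG.hasIntervalSummand hG0
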